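/- **Theorem 6.1.** A *compactum* is a compact Hausdorff space (possibly empty), $\mathbf{Comp}$ is the category of compacta and continuous maps, and all maps are continuous. A map $f:X\to Y$ between topological spaces is *skeletal* if $f^{-1}(N)$ is nowhere dense in $X$ for every nowhere dense $N\subset Y$; it is *skeletal at a point* $x\in X$ if for each neighborhood $U$ of $x$ the closure of $f(U)$ in $Y$ has non-empty interior, and *skeletal at a subset* $A\subset X$ if it is skeletal at each point of $A$. A functor $F:\mathbf{Comp}\to\mathbf{Comp}$ is called *1-mec* if it - is *monomorphic* and *epimorphic*: $Ff$ is injective (resp. surjective) whenever $f$ is injective (resp. surjective); - is *continuous*: it preserves limits of inverse spectra of compacta indexed by non-empty directed partially ordered sets; - *preserves finite 1-preimages*: for every commutative square $f\circ p_X=p_Y\circ\tilde f$ of maps $\tilde f:\tilde X\to\tilde Y$, $p_X:\tilde X\to X$, $p_Y:\tilde Y\to Y$, $f:X\to Y$ between compacta with $X$ finite, $f,\tilde f$ injective and $p_X$ bijective, if the square is *bicommutative*, i.e. $\tilde f(p_X^{-1}(x))=p_Y^{-1}(f(x))$ for all $x\in X$, then its image under $F$ is bicommutative, i.e. $F\tilde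 f\big((Fp_X)^{-1}(a)\big)=(Fp_Y)^{-1}(Ff(a))$ for all $a\in FX$. For a finite subset $A$ of a compactum $X$, write $FA\subset FX$ also for the image of the map induced by the inclusion $A\hookrightarrow X$. Let $F_\omega(X)$ be the set of all $a\in FX$ *with finite support*, i.e. with $a\in FA$ for some finite $A\subset X$; for such $a$ put $\mathrm{supp}(a)=\bigcap\{A: A\subset X \text{ finite},\ a\in FA\}$. Let $F:\mathbf{Comp}\to\mathbf{Comp}$ be a 1-mec functor, and let $f:X\to Y$ be a surjective skeletal map between compacta. Then the map $Ff:FX\to FY$ is skeletal at the subset $$\mathcal A_1=\{a\in F_\omega(X): f|_{\mathrm{supp}(a)}\text{ is injective}\}.$$ If moreover $|f^{-1}(y)|=1$ for every isolated point $y$ of $Y$, then $\mathcal A_1$ is dense in $FX$ and the map $Ff$ is skeletal. -/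

import Mathlib

open CategoryTheory CategoryTheory.Limits

universe u v

namespace CompFunctor

section Maps

variable {X : Type u} {Y : Type v} [TopologicalSpace X] [TopologicalSpace Y]

/-- A map is skeletal if preimages of nowhere dense sets are nowhere dense. -/
def IsSkeletal (f : X → Y) : Prop :=
  ∀ A : Set Y, IsNowhereDense A → IsNowhereDense (f ⁻¹' A)

/-- A map is skeletal at a point `x` if, for each neighborhood `U` of `x`, the closure of the image
of `U` has non-empty interior. -/
def IsSkeletalAt (f : X → Y) (x : X) : Prop :=
  ∀ U ∈ nhds x, (interior (closure (f '' U))).Nonempty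

/-- A map is skeletal at a subset if it is skeletal at each of its points. -/
def IsSkeletalOn (f : X → Y) (A : Set X) : Prop :=
  ∀ x ∈ A, IsSkeletalAt f x

end Maps

/-- The set of isolated points of a space. -/
def isolatedPoints (Y : Type v) [TopologicalSpace Y] : Set Y :=
  {y | IsOpen ({y} : Set Y)}

/-- The lower degeneracy set of `f`: the points whose fiber is a singleton. -/
def lowerDegeneracySet {X : Type u} {Y : Type v} (f : X → Y) : Set Y :=
  {y | ∃! x, f x = y}

/-- A functor is monomorphic if it preserves injective maps. -/
def IsMonomorphic (F : CompHaus.{u} ⥤ CompHaus.{u}) : Prop :=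
  ∀ ⦃X Y : CompHaus.{u}⦄ (f : X ⟶ Y), Function.Injective f → Function.Injective (F.map f)

/-- A functor is epimorphic if it preserves surjective maps. -/
def IsEpimorphic (F : CompHaus.{u} ⥤ CompHaus.{u}) : Prop :=
  ∀ ⦃X Y : CompHaus.{u}⦄ (f : X ⟶ Y), Function.Surjective f → Function.Surjective (F.map f)

/-- A functor is continuous if it preserves the limits of inverse spectra, that is of diagrams of
compacta indexed by (the opposite of) a non-empty directed partially ordered set. -/
def IsContinuousFunctor (F : CompHaus.{u} ⥤ CompHaus.{u}) : Prop :=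
  ∀ (J : Type u) [PartialOrder J] [IsDirectedOrder J] [Nonempty J],
    PreservesLimitsOfShape Jᵒᵖ F

/-- The square with top side `f' : X' ⟶ Y'`, bottom side `f : X ⟶ Y` and vertical sides
`p : X' ⟶ X`, `q : Y' ⟶ Y` is bicommutative if `f' (p⁻¹ (x)) = q⁻¹ (f (x))` for all `x` in `X`. -/
def IsBicommutative {X' Y' X Y : CompHaus.{u}}
    (f' : X' ⟶ Y') (p : X' ⟶ X) (q : Y' ⟶ Y) (f : X ⟶ Y) : Prop :=
  ∀ x : X, f' '' (p ⁻¹' {x}) = q ⁻¹' {f x}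

/-- A functor preserves finite 1-preimages if it preserves the bicommutativity of commutative
squares in which the horizontal maps are injective, the left vertical map is bijective and the
bottom left corner is finite. -/
def PreservesFiniteOnePreimages (F : CompHaus.{u} ⥤ CompHaus.{u}) : Prop :=
  ∀ ⦃X' Y' X Y : CompHaus.{u}⦄ (f' : X' ⟶ Y') (p : X' ⟶ X) (q : Y' ⟶ Y) (f : X ⟶ Y),
    f' ≫ q = p ≫ f → Finite X →
    Function.Injective f' → Function.Injective f → Function.Bijective p →
    IsBicommutative f' p q f → IsBicommutative (F.map f') (F.map p) (F.map q) (F.map f)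

/-- A 1-mec functor: monomorphic, epimorphic, continuous, and preserving finite 1-preimages. -/
structure IsOneMec (F : CompHaus.{u} ⥤ CompHaus.{u}) : Prop where
  monomorphic : IsMonomorphic F
  epimorphic : IsEpimorphic F
  continuous : IsContinuousFunctor F
  preserves : PreservesFiniteOnePreimages F

/-- The inclusion into a compactum `X` of its finite subspace `A`. -/
def incl {X : CompHaus.{u}} (A : Finset X) : CompHaus.of {x : X // x ∈ A} ⟶ X :=
  CompHausLike.ofHom _ ⟨Subtype.val, continuous_subtype_val⟩

/-- `FA` as a subset of `FX`, for a finite subspace `A` of `X`: the image of the map induced by the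
inclusion. -/
def image (F : CompHaus.{u} ⥤ CompHaus.{u}) {X : CompHaus.{u}} (A : Finset X) : Set (F.obj X) :=
  Set.range (F.map (incl A))

/-- The set `F_ω(X)` of the elements of `FX` with finite support. -/
def finiteSupport (F : CompHaus.{u} ⥤ CompHaus.{u}) (X : CompHaus.{u}) : Set (F.obj X) :=
  {a | ∃ A : Finset X, a ∈ image F A}

/-- The support of an element (meaningful for elements with finite support): the intersection
of all finite `A ⊆ X` such that `a ∈ FA`. -/
def supp (F : CompHaus.{u} ⥤ CompHaus.{u}) {X : CompHaus.{u}} (a : F.obj X) : Set X :=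
  {x | ∀ A : Finset X, a ∈ image F A → x ∈ A}

/-- The elements of `FX` with finite support on which `f` is injective. -/
def injSupport (F : CompHaus.{u} ⥤ CompHaus.{u}) {X Y : CompHaus.{u}} (f : X ⟶ Y) :
    Set (F.obj X) :=
  {a | a ∈ finiteSupport F X ∧ Set.InjOn f (supp F a)}

end CompFunctor

/-! Skeletality at `a ∈ FA`, with `f` injective on the finite set `A` (`isSkeletalAt_map`). Since
`F` is continuous and monomorphic, a neighborhood of `a` contains some `(Fh)⁻¹(N)` with `h` locally
constant at the points of `A`. Each `x ∈ A` gets a closed neighborhood `V x` on which `h` is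
constant, with the sets `f(V x)` disjoint; skeletality gives `y x` in the interior of `f(V x)`.
Discard from `X` the points outside `V x` lying over that interior. The remaining closed set `X₀`
still maps onto `Y`, and its image in `K × Y` has exactly one point over each `y x`. Preservation of
1-preimages carries this uniqueness over to `F`. Hence, by compactness, the point of `FY` obtained
from `a` by moving each `x` to `y x` has a neighborhood whose points all lift, through `FX₀`, into
`(Fh)⁻¹(N)`.

Density (`dense_injSupport`): finitely supported elements are dense, and their supporting points can
be moved inside small disjoint open sets until `f` separates them. A continuous map skeletal at a
dense set is skeletal. -/

namespace CompFunctor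

/-! ### Finite supports. -/

section Support

variable {F : CompHaus.{u} ⥤ CompHaus.{u}} {X Y : CompHaus.{u}}

theorem map_map_apply {Z : CompHaus.{u}} (g : X ⟶ Y) (h : Y ⟶ Z) (a : F.obj X) :
    F.map h (F.map g a) = F.map (g ≫ h) a := by
  simp

instance discreteTopology_finset (A : Finset X) : DiscreteTopology {x : X // x ∈ A} :=
  have : T1Space {x : X // x ∈ A} := T2Space.t1Space
  Finite.instDiscreteTopology

/-- A map defined on a finite subspace, as a morphism of compacta. -/
def ofFinset (A : Finset X) (s : {x : X // x ∈ A} → Y) :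
    CompHaus.of {x : X // x ∈ A} ⟶ Y :=
  CompHausLike.ofHom _ ⟨s, continuous_of_discreteTopology⟩

/-- Maps from a discrete compactum send all elements into the image of any finite set containing
their range. -/
theorem map_mem_image {Z : CompHaus.{u}} [DiscreteTopology Z] (s : Z ⟶ X) (A : Finset X)
    (h : ∀ z, s z ∈ A) (a : F.obj Z) : F.map s a ∈ image F A := by
  let t : Z ⟶ CompHaus.of {x : X // x ∈ A} :=
    CompHausLike.ofHom _ ⟨fun z => ⟨s z, h z⟩, continuous_of_discreteTopology⟩
  refine ⟨F.map t a, ?_⟩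
  rw [map_map_apply]
  rfl

/-- Points outside of some finite set carrying `a` can be dropped from any other such set, as long
as it keeps at least one point. -/
theorem mem_image_erase [DecidableEq X] (hF : IsMonomorphic F) {A B : Finset X} {a : F.obj X}
    (hA : a ∈ image F A) (hB : a ∈ image F B) {x x₀ : X} (hx : x ∉ B) (hx₀ : x₀ ∈ A)
    (hne : x₀ ≠ x) : a ∈ image F (A.erase x) := by
  obtain ⟨a₁, rfl⟩ := hA
  obtain ⟨b₁, hb⟩ := hB
  let i : CompHaus.of {x : X // x ∈ A} ⟶ CompHaus.of {x : X // x ∈ A ∪ B} :=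
    CompHausLike.ofHom _ ⟨fun z => ⟨z.1, Finset.mem_union_left _ z.2⟩,
      continuous_of_discreteTopology⟩
  let j : CompHaus.of {x : X // x ∈ B} ⟶ CompHaus.of {x : X // x ∈ A ∪ B} :=
    CompHausLike.ofHom _ ⟨fun z => ⟨z.1, Finset.mem_union_right _ z.2⟩,
      continuous_of_discreteTopology⟩
  have hinj : Function.Injective (F.map (incl (A ∪ B))) :=
    hF _ fun z w h => Subtype.ext h
  have hij : F.map i a₁ = F.map j b₁ := by
    apply hinj
    rw [map_map_apply, map_map_apply]
    exact hb.symm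
  -- `r` fixes `A` and collapses the rest of `B` to `x₀`. It fixes `a`, and since `a` also comes
  -- from `B`, which misses `x`, the result lies over `A` without `x`.
  let r : CompHaus.of {x : X // x ∈ A ∪ B} ⟶ X :=
    ofFinset (A ∪ B) fun z => if z.1 ∈ A then z.1 else x₀
  have hir : i ≫ r = incl A := by
    ext z
    exact if_pos z.2
  have key : F.map (incl A) a₁ = F.map (j ≫ r) b₁ := by
    rw [← hir, ← map_map_apply, hij, map_map_apply]
  rw [key]
  have : DiscreteTopology (CompHaus.of {x : X // x ∈ B}) :=
    inferInstanceAs (DiscreteTopology {x : X // x ∈ B})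
  refine map_mem_image _ _ (fun z => ?_) _
  change (if z.1 ∈ A then z.1 else x₀) ∈ A.erase x
  split_ifs with h
  · exact Finset.mem_erase.2 ⟨fun e => hx (e ▸ z.2), h⟩
  · exact Finset.mem_erase.2 ⟨hne, hx₀⟩

/-- Every element with finite support lies in `FA` for a set `A` that either has at most one
point or is contained in the support. -/
theorem exists_finset_subset_supp (hF : IsMonomorphic F) {a : F.obj X} (A : Finset X)
    (hA : a ∈ image F A) :
    ∃ B : Finset X, a ∈ image F B ∧ ((B : Set X).Subsingleton ∨ (B : Set X) ⊆ supp F a) := by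
  classical
  induction A using Finset.strongInduction with
  | H A ih =>
    by_cases h1 : (A : Set X).Subsingleton
    · exact ⟨A, hA, .inl h1⟩
    by_cases h2 : (A : Set X) ⊆ supp F a
    · exact ⟨A, hA, .inr h2⟩
    obtain ⟨x, hxA, hx⟩ := Set.not_subset.1 h2
    simp only [supp, Set.mem_ofPred_eq, not_forall] at hx
    obtain ⟨B, hB, hxB⟩ := hx
    obtain ⟨x₀, hx₀, hne⟩ := (Set.not_subsingleton_iff.1 h1).exists_ne x
    exact ih _ (Finset.erase_ssubset hxA) (mem_image_erase hF hA hB hxB hx₀ hne)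

/-- The support itself may fail to carry `a` (it can be empty), but then a set with at most one
point does, and injectivity there is automatic. -/
theorem exists_finset_injOn (hF : IsMonomorphic F) (f : X ⟶ Y) {a : F.obj X}
    (ha : a ∈ injSupport F f) : ∃ A : Finset X, a ∈ image F A ∧ Set.InjOn f A := by
  obtain ⟨⟨A, hA⟩, hinj⟩ := ha
  obtain ⟨B, hB, h | h⟩ := exists_finset_subset_supp hF A hA
  · exact ⟨B, hB, h.injOn _⟩
  · exact ⟨B, hB, hinj.mono h⟩

theorem mem_injSupport (f : X ⟶ Y) {a : F.obj X} {A : Finset X} (hA : a ∈ image F A)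
    (hf : Set.InjOn f A) : a ∈ injSupport F f :=
  ⟨⟨A, hA⟩, hf.mono fun _ hx => hx A hA⟩

end Support

/-! ### Finite products determine the topology of `FX`. -/

section Approximation

/-- The inverse spectrum of the finite powers of `Q`, indexed by the finite subsets of `ι`. -/
def finitePowers (ι : Type u) (Q : CompHaus.{u}) : (Finset ι)ᵒᵖ ⥤ CompHaus.{u} where
  obj E := CompHaus.of ({i : ι // i ∈ E.unop} → Q)
  map {E E'} h := CompHausLike.ofHom _
    ⟨fun z i => z ⟨i.1, leOfHom h.unop i.2⟩, by fun_prop⟩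

/-- The full power of `Q` as a cone over its finite powers. -/
def powerCone (ι : Type u) (Q : CompHaus.{u}) : Cone (finitePowers ι Q) where
  pt := CompHaus.of (ι → Q)
  π := { app := fun _ => CompHausLike.ofHom _ ⟨fun z i => z i.1, by fun_prop⟩ }

/-- The full power of `Q` is the limit of its finite powers. -/
def powerConeIsLimit (ι : Type u) (Q : CompHaus.{u}) : IsLimit (powerCone ι Q) where
  lift s := CompHausLike.ofHom _
    ⟨fun z i => (s.π.app (Opposite.op {i}) z : {j : ι // j ∈ ({i} : Finset ι)} → Q)
        ⟨i, Finset.mem_singleton_self i⟩, continuous_pi fun i =>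
        (continuous_apply (⟨i, Finset.mem_singleton_self i⟩ : {j : ι // j ∈ ({i} : Finset ι)})).comp
          (s.π.app (Opposite.op {i})).hom.hom.continuous⟩
  fac s E := by
    ext z
    funext i
    have h : ({i.1} : Finset ι) ≤ E.unop := Finset.singleton_subset_iff.2 i.2
    have := congr_arg (fun g => g z) (congr_arg (fun g => g.hom.hom) (s.w (homOfLE h).op))
    exact (congr_fun this ⟨i.1, Finset.mem_singleton_self i.1⟩).symm
  uniq s m hm := by
    ext z
    funext i
    have := congr_arg (fun g => g z) (congr_arg (fun g => g.hom.hom) (hm (Opposite.op {i})))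
    exact congr_fun this ⟨i, Finset.mem_singleton_self i⟩

/-- The diagonal product of finitely many maps out of a family. -/
def finiteDiagonal {ι : Type u} {X Q : CompHaus.{u}} (g : ι → (X ⟶ Q)) (E : Finset ι) :
    X ⟶ CompHaus.of ({i : ι // i ∈ E} → Q) :=
  CompHausLike.ofHom _ ⟨fun z i => g i.1 z, continuous_pi fun i => (g i.1).hom.hom.continuous⟩

variable {F : CompHaus.{u} ⥤ CompHaus.{u}}

/-- If a family of maps separates the points of `X`, then every neighborhood in `FX` contains a
preimage of an open set under `Fh` for some finite diagonal product `h` of the family. -/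
theorem exists_finiteDiagonal (hm : IsMonomorphic F) (hc : IsContinuousFunctor F)
    {ι : Type u} {X Q : CompHaus.{u}} (g : ι → (X ⟶ Q))
    (hg : ∀ x y, (∀ i, g i x = g i y) → x = y) {a : F.obj X} {U : Set (F.obj X)}
    (hU : U ∈ nhds a) :
    ∃ E : Finset ι, ∃ N : Set (F.obj (CompHaus.of ({i : ι // i ∈ E} → Q))), IsOpen N ∧
      F.map (finiteDiagonal g E) a ∈ N ∧ F.map (finiteDiagonal g E) ⁻¹' N ⊆ U := by
  classical
  let G : X ⟶ CompHaus.of (ι → Q) :=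
    CompHausLike.ofHom _ ⟨fun z i => g i z, continuous_pi fun i => (g i).hom.hom.continuous⟩
  have hG : Function.Injective G := fun x y h => hg x y fun i => congr_fun h i
  have hemb : Topology.IsClosedEmbedding (F.map G) :=
    (F.map G).hom.hom.continuous.isClosedEmbedding (hm G hG)
  rw [hemb.isInducing.nhds_eq_comap] at hU
  obtain ⟨W, hW, hWU⟩ := hU
  have := hc (Finset ι)
  -- `FX` embeds in `F(Q^ι)`, the limit of the `F(Q^E)` over finite `E`, so basic open sets come
  -- from a single `E`.
  have hlim : IsLimit (compHausToTop.mapCone (F.mapCone (powerCone ι Q))) :=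
    isLimitOfPreserves compHausToTop (isLimitOfPreserves F (powerConeIsLimit ι Q))
  have hbasis := TopCat.isTopologicalBasis_cofiltered_limit _ _ hlim
    (fun j => {V | IsOpen V}) (fun j => TopologicalSpace.isTopologicalBasis_opens)
    (fun _ => isOpen_univ) (fun _ _ _ h h' => IsOpen.inter h h')
    (fun _ _ f V hV => hV.preimage (TopCat.Hom.hom _).continuous)
  obtain ⟨_, ⟨E, N, hN, rfl⟩, haN, hNW⟩ := hbasis.mem_nhds_iff.1 hW
  have key : ∀ c : F.obj X, F.map (finiteDiagonal g E.unop) c =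
      F.map ((powerCone ι Q).π.app E) (F.map G c) := fun c =>
    (map_map_apply G (show CompHaus.of (ι → Q) ⟶ CompHaus.of ({i : ι // i ∈ E.unop} → Q) from
      (powerCone ι Q).π.app E) c).symm
  refine ⟨E.unop, N, hN, ?_, fun c hc' => hWU (hNW ?_)⟩
  · rw [key]
    exact haN
  · have h := Set.mem_preimage.1 hc'
    rw [key] at h
    exact h

end Approximation
-- Point-set facts about separation and skeletal maps.
section Topology

theorem regularSpace_of_compact_t2 (X : Type*) [TopologicalSpace X] [CompactSpace X]
    [T2Space X] : RegularSpace X :=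
  inferInstance

/-- The points of a compactum can be separated by functions that are locally constant at finitely
many prescribed points. -/
theorem exists_separating_eventuallyConst {X : Type*} [TopologicalSpace X] [CompactSpace X]
    [T2Space X] (A : Finset X) {x y : X} (hxy : x ≠ y) :
    ∃ g : C(X, unitInterval), g x ≠ g y ∧ ∀ z ∈ A, ∀ᶠ w in nhds z, g w = g z := by
  -- The function will be 0 near `x` and all of `A` except `y`, and 1 near `y`.
  have hfin : (insert x ((A : Set X) \ {y})).Finite := (A.finite_toSet.sdiff).insert x
  obtain ⟨u, huo, hu, hcu⟩ := normal_exists_closure_subset hfin.isClosed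
    (isClosed_singleton (x := y)).isOpen_compl (by
      rintro z (rfl | hz)
      · exact hxy
      · exact hz.2)
  obtain ⟨v, hvo, hv, hcv⟩ := normal_exists_closure_subset (isClosed_singleton (x := y))
    (isClosed_closure (s := u)).isOpen_compl (by
      rintro z rfl hz
      exact hcu hz rfl)
  obtain ⟨g, hg0, hg1, hg⟩ := exists_continuous_zero_one_of_isClosed (isClosed_closure (s := u))
    (isClosed_closure (s := v)) (Set.disjoint_left.2 fun z h h' => hcv h' h)
  have h0 : ∀ z ∈ u, g z = 0 := fun z hz => hg0 (subset_closure hz)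
  have h1 : ∀ z ∈ v, g z = 1 := fun z hz => hg1 (subset_closure hz)
  refine ⟨⟨fun z => ⟨g z, hg z⟩, by fun_prop⟩, fun h => ?_, fun z hz => ?_⟩
  · have := congr_arg Subtype.val h
    simp [h0 x (hu (.inl rfl)), h1 y (hv rfl)] at this
  · by_cases hzy : z = y
    · subst hzy
      filter_upwards [hvo.mem_nhds (hv rfl)] with w hw
      exact Subtype.ext ((h1 w hw).trans (h1 z (hv rfl)).symm)
    · have hzu : z ∈ u := hu (.inr ⟨hz, hzy⟩)
      filter_upwards [huo.mem_nhds hzu] with w hw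
      exact Subtype.ext ((h0 w hw).trans (h0 z hzu).symm)

variable {X : Type u} {Y : Type v} [TopologicalSpace X] [TopologicalSpace Y]

/-- Otherwise `f '' V` is nowhere dense, and so is its preimage, which contains the open set `V`. -/
theorem IsSkeletal.interior_closure_image_nonempty {f : X → Y} (hf : IsSkeletal f) {V : Set X}
    (hV : IsOpen V) (hne : V.Nonempty) : (interior (closure (f '' V))).Nonempty := by
  by_contra h
  have h' : interior (closure (f ⁻¹' (f '' V))) = ∅ :=
    hf _ (Set.not_nonempty_iff_eq_empty.1 h)
  have : V ⊆ interior (closure (f ⁻¹' (f '' V))) :=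
    interior_maximal ((Set.subset_preimage_image f V).trans subset_closure) hV
  rw [h'] at this
  exact hne.ne_empty (Set.subset_empty_iff.1 this)

/-- A continuous map that is skeletal at a dense subset is skeletal. -/
theorem IsSkeletalOn.isSkeletal {f : X → Y} (hc : Continuous f) {D : Set X}
    (hf : IsSkeletalOn f D) (hD : Dense D) : IsSkeletal f := by
  intro N hN
  by_contra h
  obtain ⟨x, hx, hxD⟩ := hD.inter_open_nonempty _ isOpen_interior
    (Set.nonempty_iff_ne_empty.2 h)
  have hsub : closure (f '' interior (closure (f ⁻¹' N))) ⊆ closure N := by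
    refine closure_minimal ?_ isClosed_closure
    rintro _ ⟨z, hz, rfl⟩
    exact hc.closure_preimage_subset N (interior_subset hz)
  have := (hf x hxD _ (isOpen_interior.mem_nhds hx)).mono (interior_mono hsub)
  exact this.ne_empty hN

/-- Finitely many points of disjoint open sets can be chosen so that a skeletal map that is
one-to-one over isolated points separates them. -/
theorem exists_choice_injOn [T1Space Y] {f : X → Y} (hf : IsSkeletal f)
    (hiso : isolatedPoints Y ⊆ lowerDegeneracySet f) {V : X → Set X} (hV : ∀ x, IsOpen (V x))
    (hne : ∀ x, (V x).Nonempty) (A : Finset X) (hdisj : (A : Set X).PairwiseDisjoint V) :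
    ∃ s : X → X, (∀ x ∈ A, s x ∈ V x) ∧ Set.InjOn (f ∘ s) A := by
  classical
  induction A using Finset.induction_on with
  | empty => exact ⟨id, by simp, by simp⟩
  | insert x A hxA ih =>
    obtain ⟨s, hs, hinj⟩ := ih (hdisj.subset (by simp))
    have key : ∃ z ∈ V x, ∀ w ∈ A, f (s w) ≠ f z := by
      -- An infinite image leaves room to avoid the earlier values. A finite one contains an
      -- isolated point of `Y`, whose only preimage lies in `V x`, away from the earlier points.
      by_cases hfin : (f '' V x).Finite
      · obtain ⟨y, hy⟩ := hf.interior_closure_image_nonempty (hV x) (hne x)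
        rw [hfin.isClosed.closure_eq] at hy
        have hyo : y ∈ isolatedPoints Y := by
          have h1 : IsOpen (interior (f '' V x) \ (interior (f '' V x) \ {y})) :=
            isOpen_interior.sdiff ((hfin.subset interior_subset).sdiff).isClosed
          rwa [Set.sdiff_sdiff_cancel_left (Set.singleton_subset_iff.2 hy)] at h1
        obtain ⟨z, hz, rfl⟩ := interior_subset hy
        refine ⟨z, hz, fun w hw h => ?_⟩
        have hwz : s w = z := (hiso hyo).unique h rfl
        have hwx : w ≠ x := fun e => hxA (e ▸ hw)
        exact Set.disjoint_left.1 (hdisj (by simp [hw]) (by simp) hwx) (hs w hw) (hwz ▸ hz)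
      · obtain ⟨_, ⟨z, hz, rfl⟩, hzA⟩ :=
          Set.Infinite.exists_notMem_finset hfin (A.image (f ∘ s))
        exact ⟨z, hz, fun w hw h => hzA (Finset.mem_image.2 ⟨w, hw, h⟩)⟩
    obtain ⟨z, hz, hzA⟩ := key
    have hupd : ∀ w ∈ A, Function.update s x z w = s w := fun w hw => by
      have hwx : w ≠ x := fun e => hxA (e ▸ hw)
      exact Function.update_of_ne hwx _ _
    refine ⟨Function.update s x z, fun w hw => ?_, ?_⟩
    · rcases Finset.mem_insert.1 hw with rfl | hw
      · simpa using hz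
      · rw [hupd w hw]
        exact hs w hw
    · rw [Finset.coe_insert, Set.injOn_insert (by simpa using hxA)]
      refine ⟨fun w hw w' hw' h => hinj hw hw' ?_, ?_⟩
      · simpa [hupd w hw, hupd w' hw'] using h
      · rintro ⟨w, hw, h⟩
        exact hzA w hw (by simpa [hupd w hw] using h)

end Topology

/-! ### Density and skeletality in `FX`. -/

variable {F : CompHaus.{u} ⥤ CompHaus.{u}} {X Y : CompHaus.{u}}

/-- Neighborhoods in `FX` contain preimages of open sets under maps `Fh` such that `h` is locally
constant at finitely many prescribed points. -/
theorem exists_map_eventuallyConst (hm : IsMonomorphic F) (hc : IsContinuousFunctor F)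
    (A : Finset X) {a : F.obj X} {U : Set (F.obj X)} (hU : U ∈ nhds a) :
    ∃ (K : CompHaus.{u}) (h : X ⟶ K) (N : Set (F.obj K)), IsOpen N ∧ F.map h a ∈ N ∧
      F.map h ⁻¹' N ⊆ U ∧ ∀ x ∈ A, ∀ᶠ z in nhds x, h z = h x := by
  let Q : CompHaus.{u} := CompHaus.of (ULift.{u} unitInterval)
  let ι : Type u := {g : X ⟶ Q // ∀ x ∈ A, ∀ᶠ z in nhds x, g z = g x}
  obtain ⟨E, N, hN, haN, hNU⟩ := exists_finiteDiagonal hm hc (fun i : ι => i.1)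
    (fun x y hxy => by
      by_contra hne
      obtain ⟨g, hg, hgA⟩ := exists_separating_eventuallyConst A hne
      let g' : X ⟶ Q := CompHausLike.ofHom _ ⟨fun z => ULift.up (g z), by fun_prop⟩
      exact hg (congr_arg ULift.down
        (hxy ⟨g', fun z hz => (hgA z hz).mono fun w hw => congr_arg ULift.up hw⟩))) hU
  refine ⟨_, finiteDiagonal _ E, N, hN, haN, hNU, fun x hx => ?_⟩
  have h : ∀ᶠ z in nhds x, ∀ i : {i : ι // i ∈ E}, i.1.1 z = i.1.1 x :=
    Filter.eventually_all.2 fun i => i.1.2 x hx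
  exact h.mono fun z hz => funext hz

/-- The elements with finite support are dense. -/
theorem dense_finiteSupport (hm : IsMonomorphic F) (he : IsEpimorphic F)
    (hc : IsContinuousFunctor F) : Dense (finiteSupport F X) := by
  classical
  -- A zero-dimensional compactum onto `X`: its two-valued maps separate points, so finite diagonal
  -- products have finite range.
  let Z : CompHaus.{u} := CompHaus.of (Ultrafilter X)
  let e : Z ⟶ X := CompHausLike.ofHom _ ⟨Ultrafilter.extend id, continuous_ultrafilter_extend id⟩
  have hesurj : Function.Surjective e := fun x => ⟨pure x, ultrafilter_extend_pure id x⟩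
  let Q : CompHaus.{u} := CompHaus.of (ULift.{u} Bool)
  have hsep : ∀ x y : Z, (∀ g : Z ⟶ Q, g x = g y) → x = y := by
    intro x y hxy
    by_contra hne
    obtain ⟨C, hC, hx, hy⟩ := exists_isClopen_of_totally_separated (α := Ultrafilter X) hne
    let g : Z ⟶ Q := CompHausLike.ofHom _ ⟨fun z => ULift.up (C.boolIndicator z),
      continuous_uliftUp.comp ((continuous_boolIndicator_iff_isClopen C).2 hC)⟩
    have h1 : C.boolIndicator x = C.boolIndicator y := congr_arg ULift.down (hxy g)
    rw [(Set.mem_iff_boolIndicator C x).1 hx, (Set.notMem_iff_boolIndicator C y).1 hy] at h1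
    exact Bool.noConfusion h1
  rw [dense_iff_inter_open]
  rintro U hU ⟨_, hcU⟩
  obtain ⟨c, rfl⟩ := he e hesurj ‹_›
  obtain ⟨E, N, -, hcN, hNU⟩ := exists_finiteDiagonal hm hc (fun g : Z ⟶ Q => g) hsep
    ((hU.preimage (F.map e).hom.hom.continuous).mem_nhds hcU)
  set k := finiteDiagonal (fun g : Z ⟶ Q => g) E
  have : Finite (Set.range k) :=
    (Set.toFinite (Set.range (k : Z → ({i // i ∈ E} → ULift.{u} Bool))))
  let R : CompHaus.{u} := CompHaus.of (Set.range k)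
  have hR : DiscreteTopology R :=
    inferInstanceAs (DiscreteTopology (Set.range k))
  let r : Z ⟶ R := CompHausLike.ofHom _
    ⟨Set.rangeFactorization k, k.hom.hom.continuous.subtype_mk _⟩
  let s : R ⟶ Z := CompHausLike.ofHom _ ⟨Set.rangeSplitting k, continuous_of_discreteTopology⟩
  have hk : r ≫ s ≫ k = k := by
    refine ConcreteCategory.hom_ext _ _ fun z => ?_
    exact Set.apply_rangeSplitting k (Set.rangeFactorization k z)
  refine ⟨F.map e (F.map s (F.map r c)), hNU ?_, (Set.finite_range (s ≫ e)).toFinset, ?_⟩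
  · rw [Set.mem_preimage, map_map_apply, map_map_apply, hk]
    exact hcN
  · rw [map_map_apply]
    exact map_mem_image _ _ (fun z => by simp) _

theorem dense_injSupport (hm : IsMonomorphic F) (he : IsEpimorphic F)
    (hc : IsContinuousFunctor F) (f : X ⟶ Y) (hf : IsSkeletal f)
    (hiso : isolatedPoints Y ⊆ lowerDegeneracySet f) : Dense (injSupport F f) := by
  classical
  rw [dense_iff_inter_open]
  intro U hU hne
  obtain ⟨a, haU, A, hA⟩ := (dense_finiteSupport hm he hc).inter_open_nonempty U hU hne
  obtain ⟨K, h, N, -, haN, hNU, hconst⟩ :=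
    exists_map_eventuallyConst hm hc A (hU.mem_nhds haU)
  obtain ⟨O, hO, hdisj⟩ := A.finite_toSet.t2_separation
  have hV : ∀ x : X, ∃ V ⊆ O x, IsOpen V ∧ x ∈ V ∧ (x ∈ A → ∀ z ∈ V, h z = h x) := by
    intro x
    have : ∀ᶠ z in nhds x, z ∈ O x ∧ (x ∈ A → h z = h x) := by
      refine Filter.Eventually.and ((hO x).2.mem_nhds (hO x).1) ?_
      by_cases hx : x ∈ A
      · exact (hconst x hx).mono fun z hz _ => hz
      · exact Filter.Eventually.of_forall fun z hz => (hx hz).elim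
    obtain ⟨V, hVs, hVo, hxV⟩ := eventually_nhds_iff.1 this
    exact ⟨V, fun z hz => (hVs z hz).1, hVo, hxV, fun hx z hz => (hVs z hz).2 hx⟩
  choose V hVO hVo hxV hVh using hV
  have : T1Space Y := T2Space.t1Space
  obtain ⟨s, hs, hinj⟩ := exists_choice_injOn hf hiso hVo (fun x => ⟨x, hxV x⟩) A
    (hdisj.mono_on fun x _ => hVO x)
  obtain ⟨a₀, rfl⟩ := hA
  -- Moving `x` to `s x` within `V x` is invisible to `h`, so the moved element stays in `U`.
  have hsh : ofFinset A (fun x => s x.1) ≫ h = incl A ≫ h := by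
    ext x
    exact hVh x.1 x.2 _ (hs x.1 x.2)
  refine ⟨F.map (ofFinset A fun x => s x.1) a₀, hNU ?_, mem_injSupport f (A := A.image s) ?_ ?_⟩
  · rw [map_map_apply] at haN
    rw [Set.mem_preimage, map_map_apply, hsh]
    exact haN
  · have : DiscreteTopology (CompHaus.of {x : X // x ∈ A}) := discreteTopology_finset A
    exact map_mem_image (ofFinset A fun x => s x.1) _ (fun x => Finset.mem_image_of_mem s x.2) _
  · rw [Finset.coe_image]
    exact hinj.image_of_comp

/-- If `f` is skeletal and surjective, then `Ff` is skeletal at the elements of `FA` for every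
finite `A` on which `f` is injective. -/
theorem isSkeletalAt_map (hF : IsOneMec F) (f : X ⟶ Y) (hsurj : Function.Surjective f)
    (hskel : IsSkeletal f) {A : Finset X} (hinj : Set.InjOn f A) {a : F.obj X}
    (ha : a ∈ image F A) : IsSkeletalAt (F.map f) a := by
  intro U hU
  obtain ⟨K, h, N, hN, haN, hNU, hconst⟩ :=
    exists_map_eventuallyConst hF.monomorphic hF.continuous A hU
  have hfc : Continuous f := f.hom.hom.continuous
  obtain ⟨O, hO, hdisj⟩ := (A.finite_toSet.image f).t2_separation
  have : RegularSpace X := regularSpace_of_compact_t2 X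
  have hV : ∀ x : {x : X // x ∈ A}, ∃ V ∈ nhds x.1, IsClosed V ∧
      V ⊆ {z | f z ∈ O (f x) ∧ h z = h x} := by
    intro x
    refine exists_mem_nhds_isClosed_subset (Filter.inter_mem ?_ (hconst x.1 x.2))
    exact ((hO _).2.preimage hfc).mem_nhds (hO _).1
  choose V hVx hVc hVs using hV
  have hW : ∀ x, (interior (f '' V x)).Nonempty := by
    intro x
    have hcl : IsClosed (f '' V x) := hfc.isClosedMap _ (hVc x)
    have := hskel.interior_closure_image_nonempty isOpen_interior
      ⟨x.1, mem_interior_iff_mem_nhds.2 (hVx x)⟩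
    exact this.mono (interior_mono (closure_minimal (Set.image_mono interior_subset) hcl))
  choose y hy using hW
  have huniq : ∀ x x' z, f z ∈ O (f x.1) → f z ∈ interior (f '' V x') → x' = x := by
    intro x x' z hz hz'
    obtain ⟨w, hw, hwz⟩ := interior_subset hz'
    by_contra hne
    have hne' : f x'.1 ≠ f x.1 := fun e => hne (Subtype.ext (hinj x'.2 x.2 e))
    refine Set.disjoint_left.1 (hdisj ⟨x'.1, x'.2, rfl⟩ ⟨x.1, x.2, rfl⟩ hne') ?_ hz
    rw [← hwz]
    exact (hVs x' hw).1
  let X₀ : Set X := {z | ∀ x, f z ∈ interior (f '' V x) → z ∈ V x}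
  have hX₀ : IsClosed X₀ := by
    have : X₀ = ⋂ x, ((f ⁻¹' interior (f '' V x))ᶜ ∪ V x) := by
      ext z
      simp [X₀, imp_iff_not_or]
    rw [this]
    exact isClosed_iInter fun x =>
      (isOpen_interior.preimage hfc).isClosed_compl.union (hVc x)
  have hVX₀ : ∀ x z, z ∈ V x → z ∈ X₀ := fun x z hz x' hz' => by
    rw [huniq x x' z (hVs x hz).1 hz']
    exact hz
  have : CompactSpace X₀ := isCompact_iff_compactSpace.1 hX₀.isCompact
  let g : X₀ → K × Y := fun z => (h z.1, f z.1)
  have hg : Continuous g :=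
    (h.hom.hom.continuous.comp continuous_subtype_val).prodMk (hfc.comp continuous_subtype_val)
  have : CompactSpace (Set.range g) := isCompact_iff_compactSpace.1 (isCompact_range hg)
  let XX : CompHaus.{u} := CompHaus.of X₀
  let YY : CompHaus.{u} := CompHaus.of (Set.range g)
  let i : XX ⟶ X := CompHausLike.ofHom _ ⟨Subtype.val, continuous_subtype_val⟩
  let e : XX ⟶ YY := CompHausLike.ofHom _ ⟨Set.rangeFactorization g, hg.subtype_mk _⟩
  let p : YY ⟶ K := CompHausLike.ofHom _ ⟨fun z => z.1.1, by fun_prop⟩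
  let q : YY ⟶ Y := CompHausLike.ofHom _ ⟨fun z => z.1.2, by fun_prop⟩
  have hmem : ∀ x : {x : X // x ∈ A}, (h x.1, y x) ∈ Set.range g := by
    intro x
    obtain ⟨z, hz, hzy⟩ := interior_subset (hy x)
    exact ⟨⟨z, hVX₀ x z hz⟩, Prod.ext (hVs x hz).2 hzy⟩
  have hyinj : Function.Injective y := by
    intro x x' e
    obtain ⟨z, hz, hzy⟩ := interior_subset (hy x)
    exact (huniq x x' z (hVs x hz).1 (by rw [hzy, e]; exact hy x')).symm
  let t : CompHaus.of {x : X // x ∈ A} ⟶ YY := ofFinset A fun x => ⟨(h x.1, y x), hmem x⟩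
  -- A point of `X₀` over `y x` lies in `V x`, where `h` equals `h x`; so `(h x, y x)` is the whole
  -- fiber of `q`.
  have hbi : IsBicommutative t (𝟙 _) q (ofFinset A y) := by
    intro x
    ext w
    constructor
    · rintro ⟨x', hx', rfl⟩
      have : x' = x := hx'
      subst this
      rfl
    · obtain ⟨_, z, rfl⟩ := w
      intro hw
      have hfz : f z.1 = y x := hw
      refine ⟨x, rfl, Subtype.ext (Prod.ext ?_ hfz.symm)⟩
      exact (hVs x (z.2 x (by rw [hfz]; exact hy x))).2.symm
  have hfin : Finite (CompHaus.of {x : X // x ∈ A}) :=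
    inferInstanceAs (Finite {x : X // x ∈ A})
  have hpres := hF.preserves t (𝟙 _) q (ofFinset A y) rfl hfin
    (fun x x' e => hyinj (congr_arg q e)) hyinj Function.bijective_id hbi
  obtain ⟨a₀, rfl⟩ := ha
  have hfib : ∀ b, F.map q b = F.map (ofFinset A y) a₀ → b = F.map t a₀ := by
    intro b hb
    have : b ∈ F.map q ⁻¹' {F.map (ofFinset A y) a₀} := hb
    rw [← hpres a₀] at this
    obtain ⟨a₁, ha₁, rfl⟩ := this
    simp at ha₁
    rw [ha₁]
  have htp : t ≫ p = incl A ≫ h := rfl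
  -- The points of `FY` whose entire fiber under `Fq` lies in `(Fp)⁻¹(N)`; open because `Fq` is a
  -- closed map.
  let G : Set (F.obj Y) := (F.map q '' (F.map p ⁻¹' N)ᶜ)ᶜ
  have hG : IsOpen G := by
    refine (((F.map q).hom.hom.continuous.isClosedMap) _ ?_).isOpen_compl
    exact (hN.preimage (F.map p).hom.hom.continuous).isClosed_compl
  have hbG : F.map (ofFinset A y) a₀ ∈ G := by
    rintro ⟨b, hb, hbq⟩
    refine hb ?_
    rw [hfib b hbq, Set.mem_preimage, map_map_apply, htp, ← map_map_apply]
    exact haN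
  have hGU : G ⊆ F.map f '' U := by
    intro b hb
    have hsurj' : Function.Surjective (i ≫ f) := by
      intro w
      by_cases hw : ∃ x, w ∈ interior (f '' V x)
      · obtain ⟨x, hx⟩ := hw
        obtain ⟨z, hz, rfl⟩ := interior_subset hx
        exact ⟨⟨z, hVX₀ x z hz⟩, rfl⟩
      · obtain ⟨z, rfl⟩ := hsurj w
        exact ⟨⟨z, fun x hx => (hw ⟨x, hx⟩).elim⟩, rfl⟩
    obtain ⟨c, rfl⟩ := hF.epimorphic (i ≫ f) hsurj' b
    refine ⟨F.map i c, hNU ?_, map_map_apply _ _ _⟩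
    by_contra hcN
    refine hb ⟨F.map e c, fun hc => hcN ?_, map_map_apply _ _ _⟩
    rw [Set.mem_preimage, map_map_apply] at hc ⊢
    exact hc
  exact ⟨_, interior_maximal (hGU.trans subset_closure) hG hbG⟩

end CompFunctor

theorem theorem6p1 (F : CompHaus.{u} ⥤ CompHaus.{u}) (hF : CompFunctor.IsOneMec F)
    {X Y : CompHaus.{u}} (f : X ⟶ Y) (hsurj : Function.Surjective f)
    (hskel : CompFunctor.IsSkeletal f) :
    CompFunctor.IsSkeletalOn (F.map f) (CompFunctor.injSupport F f) ∧
    (CompFunctor.isolatedPoints Y ⊆ CompFunctor.lowerDegeneracySet f →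
      Dense (CompFunctor.injSupport F f) ∧ CompFunctor.IsSkeletal (F.map f)) := by
  have h1 : CompFunctor.IsSkeletalOn (F.map f) (CompFunctor.injSupport F f) := fun a ha => by
    obtain ⟨A, hA, hinj⟩ := CompFunctor.exists_finset_injOn hF.monomorphic f ha
    exact CompFunctor.isSkeletalAt_map hF f hsurj hskel hinj hA
  refine ⟨h1, fun hiso => ?_⟩
  have h2 := CompFunctor.dense_injSupport hF.monomorphic hF.epimorphic hF.continuous f hskel hiso
  exact ⟨h2, h1.isSkeletal (F.map f).hom.hom.continuous h2⟩
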